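/- A transposition of a $*$-algebra is a $\mathbb{C}$-linear involution $a\mapsto a^{\mathrm T}$ with $(ab)^{\mathrm T}=b^{\mathrm T}a^{\mathrm T}$ and $(a^*)^{\mathrm T}=(a^{\mathrm T})^*$. A block algebra $\mathcal{S}$ is a $C^*$-algebra with a transposition which, as an algebra with involution and transposition, is isomorphic to $\mathrm{Mat}_s(\mathbb{C})$ (with transpose conjugate and transpose) for some integer $s>0$. Let $A\mapsto A^{1\otimes\mathrm T}$ be the linear map of $\mathcal{S}\otimes\mathcal{S}$ to itself with $(x\otimes y)^{1\otimes\mathrm T}=x\otimes y^{\mathrm T}$. Let $\mathcal{H}$ be the Hilbert space with orthonormal basis $v(i_1\cdots i_k)$ indexed by all finite sequences of positive integers, including the empty one, let $1_{\mathcal H}=v(\emptyset)$, let $\phi(A)=(1_{\mathcal H},A1_{\mathcal H})$ for $A\in B(\mathcal{H})$ (inner products being linear on the right), let $\Sigma_\ell\in B(\mathcal{H})$ be given by $\Sigma_\ell v(i_1\cdots i_k)=v(\ell i_1\cdots i_k)$, and put $\Xi_\ell=\mathrm{i}^\ell\Sigma_\ell+\mathrm{i}^{-\ell}\Sigma_\ell^*$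 for $\ell=1,2,\dots$. Let $\phi_{\mathcal S}:B(\mathcal{H})\otimes\mathcal{S}\to\mathcal{S}$ be the linear map with $\phi_{\mathcal S}(x\otimes y)=\phi(x)y$, and let $\phi_{\mathcal S,\mathcal S}:(B(\mathcal{H})\otimes\mathcal{S})\times(B(\mathcal{H})\otimes\mathcal{S})\to\mathcal{S}\otimes\mathcal{S}$ be the bilinear map with $\phi_{\mathcal S,\mathcal S}(x_1\otimes y_1,x_2\otimes y_2)=\phi(x_1x_2)\,y_1\otimes y_2$. An $\mathcal{S}$-linear form is an element $L=\sum_{\ell\ge1}\mathbf{X}_\ell\otimes a_\ell$ of $\mathbb{C}\langle\mathbf{X}_1,\mathbf{X}_2,\dots\rangle\otimes\mathcal{S}$ with $a_\ell\in\mathcal{S}$ vanishing for all but finitely many $\ell$; put $L(\Xi)=\sum_\ell\Xi_\ell\otimes a_\ell\in B(\mathcal{H})\otimes\mathcal{S}$. Let $\mathcal{D}_L$ be the set of $\Lambda\in\mathcal{S}$ such that $L(\Xi)-1\otimes\Lambda$ is invertible in $B(\mathcal{H})\otimes\mathcal{S}$. For $\Lambda\in\mathcal{D}_L$ put $G_L(\Lambda)=\phi_{\mathcal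 S}\big((L(\Xi)-1\otimes\Lambda)^{-1}\big)$, and for $\mathcal{S}$-linear forms $L_1,L_2$ and $\Lambda_j\in\mathcal{D}_{L_j}$ put $$G_{L_1,L_2}(\Lambda_1,\Lambda_2)=\phi_{\mathcal S,\mathcal S}\big((L_1(\Xi)-1\otimes\Lambda_1)^{-1},(L_2(\Xi)-1\otimes\Lambda_2)^{-1}\big).$$ **Proposition.** Let $\mathcal{S}$ be a block algebra. For $j=1,2$ let $L_j=\sum_\ell\mathbf{X}_\ell\otimes a_{\ell j}$ be an $\mathcal{S}$-linear form and let $\Lambda_j\in\mathcal{D}_{L_j}$. Then $G_{L_1}(\Lambda_1)$ and $G_{L_2}(\Lambda_2)$ are invertible in $\mathcal{S}$, the element $\big(G_{L_1}(\Lambda_1)^{-1}\otimes G_{L_2}(\Lambda_2)^{-1}-\sum_\ell a_{\ell1}\otimes a_{\ell2}\big)^{1\otimes\mathrm T}$ is invertible in $\mathcal{S}\otimes\mathcal{S}$, and $$G_{L_1,L_2}(\Lambda_1,\Lambda_2)=\left(\left(\Big(G_{L_1}(\Lambda_1)^{-1}\otimes G_{L_2}(\Lambda_2)^{-1}-\sum_\ell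 a_{\ell1}\otimes a_{\ell2}\Big)^{1\otimes\mathrm T}\right)^{-1}\right)^{1\otimes\mathrm T}.$$ -/

import Mathlib

open scoped TensorProduct

noncomputable section

/-! ### Boltzmann-Fock space -/

namespace BoltzmannFock

/-- Boltzmann-Fock space: the Hilbert space with orthonormal basis indexed by the finite
sequences of positive integers, including the empty one. -/
abbrev Fock : Type := lp (fun _ : List ℕ+ => ℂ) 2

/-- The basis vector `v(i₁ ⋯ iₖ)`. -/
def vec (w : List ℕ+) : Fock := lp.single 2 w (1 : ℂ)

/-- The vacuum vector `1_H = v(∅)`. -/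
def vacuum : Fock := vec []

theorem norm_vec (w : List ℕ+) : ‖vec w‖ = 1 := by
  simp [vec, lp.norm_single]

theorem orthonormal_vec : Orthonormal ℂ vec := by
  refine ⟨norm_vec, fun v w hvw => ?_⟩
  simp only [vec, lp.inner_single_left, lp.single_apply]
  rw [Pi.single_eq_of_ne hvw, inner_zero_right]

theorem orthonormal_vec_cons (i : ℕ+) : Orthonormal ℂ (fun w : List ℕ+ => vec (i :: w)) :=
  orthonormal_vec.comp (fun w : List ℕ+ => i :: w) (List.cons_injective)

/-- The (left) raising operator `Σ_i`; see `raise_vec` for its characterization. -/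
def raise (i : ℕ+) : Fock →L[ℂ] Fock :=
  (orthonormal_vec_cons i).orthogonalFamily.linearIsometry.toContinuousLinearMap

/-- `Σ_i v(i₁ ⋯ iₖ) = v(i i₁ ⋯ iₖ)`. -/
theorem raise_vec (i : ℕ+) (w : List ℕ+) : raise i (vec w) = vec (i :: w) := by
  simp only [raise, vec, LinearIsometry.coe_toContinuousLinearMap]
  rw [OrthogonalFamily.linearIsometry_apply_single]
  simp

/-- The C*-algebra `B(H)` of bounded operators on Boltzmann-Fock space. -/
def BH : Type := Fock →L[ℂ] Fock

instance : CStarAlgebra BH := inferInstanceAs (CStarAlgebra (Fock →L[ℂ] Fock))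

/-- An element of `B(H)` viewed as an operator. -/
def BH.toCLM (A : BH) : Fock →L[ℂ] Fock := A

/-- The raising operator `Σ_i` as an element of `B(H)`. -/
def Sig (i : ℕ+) : BH := raise i

/-- The semicircular variables `Ξ_ℓ = i^ℓ Σ_ℓ + i^{-ℓ} Σ_ℓ^*`, for `ℓ = 1, 2, 3, …`. -/
def Xi (l : ℕ+) : BH :=
  Complex.I ^ (l : ℕ) • Sig l + (Complex.I ^ (l : ℕ))⁻¹ • star (Sig l)

/-- The involution of `B(H)` is the Hilbert space adjoint. -/
theorem toCLM_star (A : BH) : (star A).toCLM = ContinuousLinearMap.adjoint A.toCLM := rfl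

/-- The product of `B(H)` is composition of operators. -/
theorem toCLM_mul (A B : BH) : (A * B).toCLM = A.toCLM ∘L B.toCLM := rfl

/-- The vectorial state `φ(A) = (1_H, A 1_H)` on `B(H)`. -/
def state : BH →ₗ[ℂ] ℂ where
  toFun A := inner ℂ vacuum (A.toCLM vacuum)
  map_add' A B := inner_add_right (𝕜 := ℂ) vacuum
    (A.toCLM vacuum) (B.toCLM vacuum)
  map_smul' c A := inner_smul_right (𝕜 := ℂ) vacuum (A.toCLM vacuum) c

end BoltzmannFock

/-! ### Block algebras -/

/-- A transposition of a `*`-algebra. -/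
structure Transposition (A : Type*) [Ring A] [StarRing A] [Algebra ℂ A] where
  /-- the underlying linear map `a ↦ a^T` -/
  toLin : A →ₗ[ℂ] A
  involutive : ∀ a, toLin (toLin a) = a
  map_star : ∀ a, toLin (star a) = star (toLin a)
  map_mul : ∀ a b, toLin (a * b) = toLin b * toLin a

/-- A block algebra: a C*-algebra with a transposition, isomorphic, as algebra with involution
and transposition, to the algebra of `s × s` complex matrices for some `s > 0`. -/
class BlockAlgebra (S : Type*) [CStarAlgebra S] where
  /-- the transposition with which the block algebra is equipped -/
  transposition : Transposition S
  exists_iso : ∃ s : ℕ, 0 < s ∧ ∃ e : S ≃⋆ₐ[ℂ] Matrix (Fin s) (Fin s) ℂ,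
    ∀ x : S, e (transposition.toLin x) = Matrix.transpose (e x)

/-- The half-transpose map of `S ⊗ S`, given by `(x ⊗ y)^{1 ⊗ T} = x ⊗ y^T`. -/
def halfTranspose (S : Type*) [CStarAlgebra S] [BlockAlgebra S] : S ⊗[ℂ] S →ₗ[ℂ] S ⊗[ℂ] S :=
  TensorProduct.map LinearMap.id (BlockAlgebra.transposition (S := S)).toLin

/-! ### Extensions of states -/

/-- The `S`-linear extension of a functional `φ`; see `linExt_tmul`. -/
def linExt {A : Type*} [Ring A] [Algebra ℂ A] (φ : A →ₗ[ℂ] ℂ)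
    (S : Type*) [Ring S] [Algebra ℂ S] : A ⊗[ℂ] S →ₗ[ℂ] S :=
  (TensorProduct.lid ℂ S).toLinearMap ∘ₗ TensorProduct.map φ LinearMap.id

theorem linExt_tmul {A : Type*} [Ring A] [Algebra ℂ A] (φ : A →ₗ[ℂ] ℂ)
    (S : Type*) [Ring S] [Algebra ℂ S] (x : A) (y : S) :
    linExt φ S (x ⊗ₜ[ℂ] y) = φ x • y := by
  simp [linExt]

/-- The `S`-bilinear extension of a functional `φ`; see `bilinExt_tmul`. -/
def bilinExt {A : Type*} [Ring A] [Algebra ℂ A] (φ : A →ₗ[ℂ] ℂ)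
    (S : Type*) [Ring S] [Algebra ℂ S] :
    A ⊗[ℂ] S →ₗ[ℂ] A ⊗[ℂ] S →ₗ[ℂ] S ⊗[ℂ] S :=
  TensorProduct.curry
    ((TensorProduct.lid ℂ (S ⊗[ℂ] S)).toLinearMap
      ∘ₗ TensorProduct.map (φ ∘ₗ LinearMap.mul' ℂ A) LinearMap.id
      ∘ₗ (TensorProduct.tensorTensorTensorComm ℂ A S A S).toLinearMap)

theorem bilinExt_tmul {A : Type*} [Ring A] [Algebra ℂ A] (φ : A →ₗ[ℂ] ℂ)
    (S : Type*) [Ring S] [Algebra ℂ S] (x₁ x₂ : A) (y₁ y₂ : S) :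
    bilinExt φ S (x₁ ⊗ₜ[ℂ] y₁) (x₂ ⊗ₜ[ℂ] y₂) = φ (x₁ * x₂) • (y₁ ⊗ₜ[ℂ] y₂) := by
  simp [bilinExt]

/-! ### `S`-linear forms -/

/-- `L ∈ ℂ⟨X⟩ ⊗ S` is the `S`-linear form with Hamel expansion `L = ∑_ℓ X_ℓ ⊗ a_ℓ`, where the
Hamel coefficients `a_ℓ`, `ℓ = 1, 2, 3, …`, vanish for all but finitely many `ℓ`. -/
def HasHamelExpansion {S : Type*} [Ring S] [Algebra ℂ S]
    (L : FreeAlgebra ℂ ℕ+ ⊗[ℂ] S) (a : ℕ+ →₀ S) : Prop :=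
  L = a.sum fun l x => FreeAlgebra.ι ℂ l ⊗ₜ[ℂ] x

/-- The evaluation `L(ξ) ∈ A ⊗ S` at a sequence `ξ` in an algebra `A`: substitute `ξ_ℓ` for
`X_ℓ` in the first tensor factor. -/
def evalAt {A : Type*} [Ring A] [Algebra ℂ A] {S : Type*} [Ring S] [Algebra ℂ S]
    (L : FreeAlgebra ℂ ℕ+ ⊗[ℂ] S) (ξ : ℕ+ → A) : A ⊗[ℂ] S :=
  Algebra.TensorProduct.map (FreeAlgebra.lift ℂ ξ) (AlgHom.id ℂ S) L

theorem HasHamelExpansion.evalAt_eq {A : Type*} [Ring A] [Algebra ℂ A]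
    {S : Type*} [Ring S] [Algebra ℂ S] {L : FreeAlgebra ℂ ℕ+ ⊗[ℂ] S} {a : ℕ+ →₀ S}
    (h : HasHamelExpansion L a) (ξ : ℕ+ → A) :
    evalAt L ξ = a.sum fun l x => ξ l ⊗ₜ[ℂ] x := by
  rw [HasHamelExpansion] at h
  rw [evalAt, h, Finsupp.sum, map_sum]
  simp [Finsupp.sum]

/-! ### The special functions `G_L` and `G_{L₁,L₂}` -/

section SpecialFunctions

variable {S : Type*} [CStarAlgebra S]

/-- The element `L(Ξ) - 1 ⊗ Λ` of `B(H) ⊗ S`. -/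
def shifted (L : FreeAlgebra ℂ ℕ+ ⊗[ℂ] S) (Λ : S) :
    BoltzmannFock.BH ⊗[ℂ] S :=
  evalAt L BoltzmannFock.Xi - (1 : BoltzmannFock.BH) ⊗ₜ[ℂ] Λ

/-- The set `D_L` of those `Λ` for which `L(Ξ) - 1 ⊗ Λ` is invertible in `B(H) ⊗ S`. -/
def domainD (L : FreeAlgebra ℂ ℕ+ ⊗[ℂ] S) : Set S :=
  {Λ | IsUnit (shifted L Λ)}

/-- `G_L(Λ) = φ_S((L(Ξ) - 1 ⊗ Λ)⁻¹)`, meaningful for `Λ ∈ D_L`. -/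
def funG (L : FreeAlgebra ℂ ℕ+ ⊗[ℂ] S) (Λ : S) : S :=
  linExt BoltzmannFock.state S (Ring.inverse (shifted L Λ))

/-- `G_{L₁,L₂}(Λ₁,Λ₂) = φ_{S,S}((L₁(Ξ) - 1 ⊗ Λ₁)⁻¹, (L₂(Ξ) - 1 ⊗ Λ₂)⁻¹)`, meaningful for
`Λ₁ ∈ D_{L₁}` and `Λ₂ ∈ D_{L₂}`. -/
def funGG (L₁ L₂ : FreeAlgebra ℂ ℕ+ ⊗[ℂ] S) (Λ₁ Λ₂ : S) : S ⊗[ℂ] S :=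
  bilinExt BoltzmannFock.state S
    (Ring.inverse (shifted L₁ Λ₁)) (Ring.inverse (shifted L₂ Λ₂))

end SpecialFunctions

end

/-!
Right raising operators commute with the left ones up to the vacuum projection `p`. Twisting
`v(w) ↦ v(w j)` by the phase `√-1 ^ j` gives operators `ρ_j` with `Ξ_j 1_H = ρ_j 1_H` and
`[ρ_j^*, Ξ_l] = [Ξ_l, ρ_j] = δ_{jl} p`. Hence commuting `ρ_j ⊗ 1` or `ρ_j^* ⊗ 1` past the inverse
`R` of `M = ∑_l Ξ_l ⊗ a_l - 1 ⊗ Λ` only produces `R (p ⊗ a_j) R`, a term that factors under `φ_S`.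

Applying `φ_S` to `M R = R M = 1` therefore yields the Schwinger-Dyson equations
`-(Λ + ∑_l a_l G a_l) G = G (-(Λ + ∑_l a_l G a_l)) = 1`, so `G = φ_S(R)` is invertible. Inserting
`1 = p + ∑_j ρ_j ρ_j^*` between two resolvents yields
`φ_S(R₁ R₂) = G₁ G₂ + ∑_j G₁ a_j φ_S(R₁ R₂) b_j G₂`. Over `S ⊗ S`, with `a_j` in the first factor
and `b_j` in the second, the half-transpose turns this into the statement that `φ(R₁ R₂)^{1 ⊗ T}` is
a right inverse, and `φ(R₂ R₁)^{1 ⊗ T}` a left inverse, of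
`(G₁⁻¹ ⊗ G₂⁻¹ - ∑_j a_j ⊗ b_j)^{1 ⊗ T}`; hence the two agree and the inverse is two-sided.
-/

open scoped Ring

namespace BoltzmannFock

theorem ext_inner_vec {x y : Fock} (h : ∀ w, inner ℂ (vec w) x = inner ℂ (vec w) y) : x = y :=
  lp.ext (funext fun w => by simpa [vec, lp.inner_single_left] using h w)

theorem inner_vec_vec (v w : List ℕ+) :
    inner ℂ (vec v) (vec w) = if v = w then (1 : ℂ) else 0 :=
  orthonormal_iff_ite.mp orthonormal_vec v w

theorem BH.inner_star_left (A : BH) (x y : Fock) :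
    inner ℂ ((star A).toCLM x) y = inner ℂ x (A.toCLM y) :=
  ContinuousLinearMap.adjoint_inner_left A.toCLM y x

theorem BH.inner_star_right (A : BH) (x y : Fock) :
    inner ℂ x ((star A).toCLM y) = inner ℂ (A.toCLM x) y :=
  ContinuousLinearMap.adjoint_inner_right A.toCLM x y

theorem BH.toCLM_mul_apply (A B : BH) (x : Fock) : (A * B).toCLM x = A.toCLM (B.toCLM x) := rfl

theorem BH.toCLM_add_apply (A B : BH) (x : Fock) : (A + B).toCLM x = A.toCLM x + B.toCLM x := rfl

theorem BH.toCLM_smul_apply (c : ℂ) (A : BH) (x : Fock) : (c • A).toCLM x = c • A.toCLM x := rfl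

theorem BH.ext_vec {A B : BH} (h : ∀ w, A.toCLM (vec w) = B.toCLM (vec w)) : A = B := by
  refine star_injective (ContinuousLinearMap.ext fun x => ext_inner_vec fun w => ?_)
  change inner ℂ (vec w) ((star A).toCLM x) = inner ℂ (vec w) ((star B).toCLM x)
  rw [BH.inner_star_right, BH.inner_star_right, h]

theorem Sig_vec (l : ℕ+) (w : List ℕ+) : (Sig l).toCLM (vec w) = vec (l :: w) := raise_vec l w

theorem star_Sig_vacuum (l : ℕ+) : (star (Sig l)).toCLM vacuum = 0 :=
  ext_inner_vec fun w => by
    rw [BH.inner_star_right, Sig_vec, vacuum, inner_vec_vec, inner_zero_right, if_neg (by simp)]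

theorem star_I_pow (n : ℕ) : star (Complex.I ^ n) = (Complex.I ^ n)⁻¹ := by
  rw [star_pow, ← inv_pow, Complex.inv_I, Complex.star_def, Complex.conj_I]

theorem star_Xi (l : ℕ+) : star (Xi l) = Xi l := by
  rw [Xi, star_add, star_smul, star_smul, star_star, star_inv₀, star_I_pow, inv_inv, add_comm]

theorem orthonormal_vec_append (i : ℕ+) : Orthonormal ℂ (fun w : List ℕ+ => vec (w ++ [i])) :=
  orthonormal_vec.comp (fun w : List ℕ+ => w ++ [i]) (List.append_left_injective [i])

/-- The right raising operator `ρ_j v(w) = i^j v(w j)`. The phase makes `ρ_j` agree with `Ξ_j` on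
the vacuum and keeps scalars out of its commutators with the `Ξ_l`. -/
noncomputable def rightRaise (j : ℕ+) : BH :=
  Complex.I ^ (j : ℕ) •
    (orthonormal_vec_append j).orthogonalFamily.linearIsometry.toContinuousLinearMap

theorem rightRaise_vec (j : ℕ+) (w : List ℕ+) :
    (rightRaise j).toCLM (vec w) = Complex.I ^ (j : ℕ) • vec (w ++ [j]) := by
  change Complex.I ^ (j : ℕ) • (orthonormal_vec_append j).orthogonalFamily.linearIsometry _ = _
  rw [vec, OrthogonalFamily.linearIsometry_apply_single, LinearIsometry.toSpanSingleton_apply,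
    one_smul]

theorem star_rightRaise_vacuum (j : ℕ+) : (star (rightRaise j)).toCLM vacuum = 0 :=
  ext_inner_vec fun w => by
    rw [BH.inner_star_right, rightRaise_vec, vacuum, inner_smul_left, inner_vec_vec,
      inner_zero_right, if_neg (by simp), mul_zero]

theorem star_rightRaise_vec_append (i j : ℕ+) (w : List ℕ+) :
    (star (rightRaise i)).toCLM (vec (w ++ [j]))
      = if i = j then (Complex.I ^ (i : ℕ))⁻¹ • vec w else 0 := by
  refine ext_inner_vec fun v => ?_
  have hvw : v ++ [i] = w ++ [j] ↔ v = w ∧ i = j := by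
    rw [← List.concat_eq_append, ← List.concat_eq_append, List.concat_inj]
  rw [BH.inner_star_right, rightRaise_vec, inner_smul_left, inner_vec_vec, ← star_I_pow]
  by_cases hij : i = j <;> simp [hij, hvw, inner_vec_vec]

theorem rightRaise_star_rightRaise_vec_append (i j : ℕ+) (w : List ℕ+) :
    (rightRaise i).toCLM ((star (rightRaise i)).toCLM (vec (w ++ [j])))
      = if i = j then vec (w ++ [j]) else 0 := by
  rw [star_rightRaise_vec_append]
  split_ifs with hij
  · rw [map_smul, rightRaise_vec, hij, inv_smul_smul₀ (pow_ne_zero _ Complex.I_ne_zero)]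
  · rw [map_zero]

/-- The orthogonal projection onto the vacuum vector. -/
noncomputable def vacuumProj : BH := InnerProductSpace.rankOne ℂ vacuum vacuum

theorem vacuumProj_apply (x : Fock) : vacuumProj.toCLM x = inner ℂ vacuum x • vacuum := rfl

theorem star_vacuumProj : star vacuumProj = vacuumProj :=
  InnerProductSpace.adjoint_rankOne vacuum vacuum

theorem vacuumProj_vec (w : List ℕ+) :
    vacuumProj.toCLM (vec w) = if w = [] then vacuum else 0 := by
  rw [vacuumProj_apply, vacuum, inner_vec_vec, ite_smul, one_smul, zero_smul]
  simp only [eq_comm]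

theorem Xi_vacuum (l : ℕ+) : (Xi l).toCLM vacuum = (rightRaise l).toCLM vacuum := by
  rw [Xi, BH.toCLM_add_apply, BH.toCLM_smul_apply, BH.toCLM_smul_apply, star_Sig_vacuum, smul_zero,
    add_zero, vacuum, Sig_vec, rightRaise_vec, List.nil_append]

theorem Sig_mul_rightRaise (l i : ℕ+) : Sig l * rightRaise i = rightRaise i * Sig l :=
  BH.ext_vec fun w => by
    simp only [BH.toCLM_mul_apply, Sig_vec, rightRaise_vec, map_smul, List.cons_append]

theorem star_rightRaise_mul_Sig (i l : ℕ+) :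
    star (rightRaise i) * Sig l = Sig l * star (rightRaise i)
      + (if i = l then (Complex.I ^ (l : ℕ))⁻¹ else 0) • vacuumProj := by
  refine BH.ext_vec fun w => ?_
  rw [BH.toCLM_add_apply, BH.toCLM_smul_apply, BH.toCLM_mul_apply, BH.toCLM_mul_apply, Sig_vec,
    vacuumProj_vec]
  rcases List.eq_nil_or_concat' w with rfl | ⟨u, j, rfl⟩
  · have h := star_rightRaise_vec_append i l []
    rw [List.nil_append] at h
    rw [h, ← vacuum, star_rightRaise_vacuum]
    by_cases hil : i = l <;> simp [hil]
  · rw [← List.cons_append, star_rightRaise_vec_append, star_rightRaise_vec_append]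
    by_cases hij : i = j <;> simp [hij, Sig_vec]

theorem lie_star_rightRaise_Xi (i l : ℕ+) :
    ⁅star (rightRaise i), Xi l⁆ = if i = l then vacuumProj else 0 := by
  have hstar : star (rightRaise i) * star (Sig l) = star (Sig l) * star (rightRaise i) := by
    rw [← star_mul, ← star_mul, Sig_mul_rightRaise]
  rw [Ring.lie_def, Xi, mul_add, add_mul, mul_smul_comm, mul_smul_comm, smul_mul_assoc,
    smul_mul_assoc, star_rightRaise_mul_Sig, hstar, smul_add, smul_smul]
  by_cases hil : i = l <;> simp [hil, Complex.I_ne_zero]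

theorem lie_rightRaise_Xi (i l : ℕ+) :
    ⁅rightRaise i, Xi l⁆ = if i = l then -vacuumProj else 0 := by
  have h := congrArg (-star ·) (lie_star_rightRaise_Xi i l)
  simp only [Ring.lie_def, star_sub, star_mul, star_star, star_Xi, neg_sub] at h
  rw [Ring.lie_def, h]
  split_ifs
  · rw [star_vacuumProj]
  · rw [star_zero, neg_zero]

theorem state_apply (A : BH) : state A = inner ℂ vacuum (A.toCLM vacuum) := rfl

theorem state_one : state 1 = 1 := by
  rw [state_apply]
  exact (inner_vec_vec [] []).trans (if_pos rfl)

theorem state_mul_vacuumProj_mul (A B : BH) : state (A * vacuumProj * B) = state A * state B := by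
  rw [state_apply, BH.toCLM_mul_apply, BH.toCLM_mul_apply, vacuumProj_apply, map_smul,
    inner_smul_right, mul_comm]
  rfl

theorem state_rightRaise_mul (i : ℕ+) (A : BH) : state (rightRaise i * A) = 0 := by
  rw [state_apply, BH.toCLM_mul_apply, ← BH.inner_star_left, star_rightRaise_vacuum,
    inner_zero_left]

theorem state_mul_star_rightRaise (A : BH) (i : ℕ+) : state (A * star (rightRaise i)) = 0 := by
  rw [state_apply, BH.toCLM_mul_apply, star_rightRaise_vacuum, map_zero, inner_zero_right]

theorem state_mul_Xi (A : BH) (l : ℕ+) : state (A * Xi l) = state (A * rightRaise l) := by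
  rw [state_apply, state_apply, BH.toCLM_mul_apply, BH.toCLM_mul_apply, Xi_vacuum]

theorem state_Xi_mul (l : ℕ+) (A : BH) : state (Xi l * A) = state (star (rightRaise l) * A) := by
  rw [state_apply, state_apply, BH.toCLM_mul_apply, BH.toCLM_mul_apply, ← BH.inner_star_left,
    star_Xi, Xi_vacuum, BH.inner_star_right]

theorem eq_vacuum_add_sum_rightRaise {s : Finset ℕ+} {x : Fock}
    (hx : ∀ i ∉ s, (star (rightRaise i)).toCLM x = 0) :
    x = inner ℂ vacuum x • vacuum
      + ∑ i ∈ s, (rightRaise i).toCLM ((star (rightRaise i)).toCLM x) := by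
  refine ext_inner_vec fun w => ?_
  have hsum : inner ℂ (vec w) (∑ i ∈ s, (rightRaise i).toCLM ((star (rightRaise i)).toCLM x))
      = ∑ i ∈ s, inner ℂ ((rightRaise i).toCLM ((star (rightRaise i)).toCLM (vec w))) x := by
    simp only [inner_sum, ← BH.inner_star_left, star_star]
  rw [inner_add_right, inner_smul_right, hsum, vacuum, inner_vec_vec]
  rcases List.eq_nil_or_concat' w with rfl | ⟨u, j, rfl⟩
  · rw [if_pos rfl, mul_one, ← vacuum]
    simp only [star_rightRaise_vacuum, map_zero, inner_zero_left, Finset.sum_const_zero, add_zero]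
  rw [if_neg (by simp), mul_zero, zero_add]
  by_cases hj : j ∈ s
  · simp [rightRaise_star_rightRaise_vec_append, apply_ite (inner ℂ · x), hj]
  · have hjj := rightRaise_star_rightRaise_vec_append j j u
    rw [if_pos rfl] at hjj
    rw [Finset.sum_eq_zero fun i hi => ?_, ← hjj, ← BH.inner_star_right, hx j hj, inner_zero_right]
    rw [rightRaise_star_rightRaise_vec_append, if_neg (ne_of_mem_of_not_mem hi hj),
      inner_zero_left]

theorem state_mul_eq_add_sum {s : Finset ℕ+} {B : BH}
    (hB : ∀ i ∉ s, Commute (star (rightRaise i)) B) (A : BH) :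
    state (A * B) = state A * state B
      + ∑ i ∈ s, state (A * (rightRaise i * (star (rightRaise i) * B))) := by
  have hB' (i) (hi : i ∉ s) : (star (rightRaise i)).toCLM (B.toCLM vacuum) = 0 := by
    rw [← BH.toCLM_mul_apply, (hB i hi).eq, BH.toCLM_mul_apply, star_rightRaise_vacuum, map_zero]
  have h := congrArg (fun x => inner ℂ vacuum (A.toCLM x)) (eq_vacuum_add_sum_rightRaise hB')
  simp only [map_add, map_smul, map_sum, inner_add_right, inner_smul_right, inner_sum] at h
  simpa only [state_apply, BH.toCLM_mul_apply, mul_comm] using h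

end BoltzmannFock

section Extensions

variable {A : Type*} [Ring A] [Algebra ℂ A] {S T : Type*} [Ring S] [Algebra ℂ S] [Ring T]
  [Algebra ℂ T]

theorem linExt_tmul_mul (φ : A →ₗ[ℂ] ℂ) (x : A) (s : S) (Y : A ⊗[ℂ] S) :
    linExt φ S (x ⊗ₜ s * Y) = s * linExt (φ ∘ₗ LinearMap.mulLeft ℂ x) S Y := by
  induction Y with
  | zero => simp
  | add Y₁ Y₂ h₁ h₂ => rw [mul_add, map_add, map_add, h₁, h₂, mul_add]
  | tmul y t => simp [linExt_tmul]

theorem linExt_mul_tmul (φ : A →ₗ[ℂ] ℂ) (X : A ⊗[ℂ] S) (y : A) (s : S) :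
    linExt φ S (X * y ⊗ₜ s) = linExt (φ ∘ₗ LinearMap.mulRight ℂ y) S X * s := by
  induction X with
  | zero => simp
  | add X₁ X₂ h₁ h₂ => rw [add_mul, map_add, map_add, h₁, h₂, add_mul]
  | tmul x t => simp [linExt_tmul]

theorem linExt_tmul_mul_eq_zero {φ : A →ₗ[ℂ] ℂ} {x : A} (hx : ∀ y, φ (x * y) = 0) (s : S)
    (Y : A ⊗[ℂ] S) : linExt φ S (x ⊗ₜ s * Y) = 0 := by
  have hφ : φ ∘ₗ LinearMap.mulLeft ℂ x = 0 := LinearMap.ext hx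
  rw [linExt_tmul_mul, hφ]
  simp [linExt]

theorem linExt_mul_tmul_eq_zero {φ : A →ₗ[ℂ] ℂ} {y : A} (hy : ∀ x, φ (x * y) = 0)
    (X : A ⊗[ℂ] S) (s : S) : linExt φ S (X * y ⊗ₜ s) = 0 := by
  have hφ : φ ∘ₗ LinearMap.mulRight ℂ y = 0 := LinearMap.ext hy
  rw [linExt_mul_tmul, hφ]
  simp [linExt]

theorem linExt_mul_tmul_mul {φ : A →ₗ[ℂ] ℂ} {p : A} (hp : ∀ x y, φ (x * p * y) = φ x * φ y)
    (X Y : A ⊗[ℂ] S) (s : S) :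
    linExt φ S (X * p ⊗ₜ s * Y) = linExt φ S X * s * linExt φ S Y := by
  induction X with
  | zero => simp
  | add X₁ X₂ h₁ h₂ => simp only [add_mul, map_add, h₁, h₂]
  | tmul x t =>
    induction Y with
    | zero => simp
    | add Y₁ Y₂ h₁ h₂ => simp only [mul_add, map_add, h₁, h₂]
    | tmul y u => simp [linExt_tmul, hp, smul_smul, mul_comm]

theorem linExt_map (φ : A →ₗ[ℂ] ℂ) (f : S →ₐ[ℂ] T) (X : A ⊗[ℂ] S) :
    linExt φ T (Algebra.TensorProduct.map (AlgHom.id ℂ A) f X) = f (linExt φ S X) := by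
  induction X with
  | zero => simp
  | add X₁ X₂ h₁ h₂ => simp only [map_add, h₁, h₂]
  | tmul x s => simp [linExt_tmul]

theorem bilinExt_eq_linExt (φ : A →ₗ[ℂ] ℂ) (X Y : A ⊗[ℂ] S) :
    bilinExt φ S X Y = linExt φ (S ⊗[ℂ] S)
      (Algebra.TensorProduct.map (AlgHom.id ℂ A) Algebra.TensorProduct.includeLeft X
        * Algebra.TensorProduct.map (AlgHom.id ℂ A) Algebra.TensorProduct.includeRight Y) := by
  induction X with
  | zero => simp
  | add X₁ X₂ h₁ h₂ => simp only [map_add, LinearMap.add_apply, add_mul, h₁, h₂]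
  | tmul x s =>
    induction Y with
    | zero => simp
    | add Y₁ Y₂ h₁ h₂ => simp only [map_add, mul_add, h₁, h₂]
    | tmul y t => simp [linExt_tmul, bilinExt_tmul]

end Extensions

section Inverse

theorem ringInverse_eq_of_mul_eq_one {M : Type*} [MonoidWithZero M] {x y : M} (hxy : x * y = 1)
    (hyx : y * x = 1) : x⁻¹ʳ = y :=
  Ring.inverse_unit ⟨x, y, hxy, hyx⟩

theorem map_ringInverse {M N F : Type*} [MonoidWithZero M] [MonoidWithZero N] [FunLike F M N]
    [MonoidHomClass F M N] (f : F) {x : M} (hx : IsUnit x) : f x⁻¹ʳ = (f x)⁻¹ʳ := by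
  refine (ringInverse_eq_of_mul_eq_one ?_ ?_).symm
  · rw [← map_mul, Ring.mul_inverse_cancel _ hx, map_one]
  · rw [← map_mul, Ring.inverse_mul_cancel _ hx, map_one]

theorem lie_ringInverse {R : Type*} [Ring R] {y : R} (hy : IsUnit y) (x : R) :
    ⁅x, y⁻¹ʳ⁆ = -(y⁻¹ʳ * ⁅x, y⁆ * y⁻¹ʳ) := by
  rw [Ring.lie_def, Ring.lie_def, mul_sub, sub_mul, mul_assoc, mul_assoc,
    Ring.mul_inverse_cancel _ hy, mul_one, Ring.inverse_mul_cancel_left _ _ hy, neg_sub]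

theorem sub_mul_eq_one_of_eq_add {R : Type*} [Ring R] {g g' m u : R} (hg : g' * g = 1)
    (hu : u = g + g * m * u) : (g' - m) * u = 1 := by
  rw [sub_mul, sub_eq_iff_eq_add]
  nth_rw 1 [hu]
  rw [mul_add, ← mul_assoc, ← mul_assoc, hg, one_mul]

theorem mul_sub_eq_one_of_eq_add {R : Type*} [Ring R] {g g' m u : R} (hg : g * g' = 1)
    (hu : u = g + u * m * g) : u * (g' - m) = 1 := by
  rw [mul_sub, sub_eq_iff_eq_add]
  nth_rw 1 [hu]
  rw [add_mul, mul_assoc, hg, mul_one]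

end Inverse

section Pencil

open BoltzmannFock

variable {T : Type*} [Ring T] [Algebra ℂ T]

theorem linExt_state_mul_eq_add_sum {s : Finset ℕ+} {Y : BH ⊗[ℂ] T}
    (hY : ∀ i ∉ s, Commute (star (rightRaise i) ⊗ₜ 1) Y) (X : BH ⊗[ℂ] T) :
    linExt state T (X * Y) = linExt state T X * linExt state T Y
      + ∑ i ∈ s, linExt state T
          (X * rightRaise i ⊗ₜ 1 * (star (rightRaise i) ⊗ₜ 1 * Y)) := by
  -- The centralizer of `C ⊗ 1` is the tensor product of the centralizer of `C` with `T`, so it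
  -- suffices to treat `Y = z ⊗ t` with `z` commuting with the `ρ_i^*`, `i ∉ s`.
  let C : Set BH := (fun i => star (rightRaise i)) '' (↑s)ᶜ
  have hYC : Y ∈ Subalgebra.centralizer ℂ
      (Algebra.TensorProduct.includeLeft (R := ℂ) (S := ℂ) (B := T) '' C) := by
    rw [Subalgebra.mem_centralizer_iff]
    rintro _ ⟨_, ⟨i, hi, rfl⟩, rfl⟩
    exact hY i hi
  rw [Subalgebra.centralizer_coe_image_includeLeft_eq_center_tensorProduct] at hYC
  obtain ⟨Z, rfl⟩ := (AlgHom.mem_range _).mp hYC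
  clear hY hYC
  induction Z with
  | zero => simp
  | add Z₁ Z₂ h₁ h₂ =>
    simp only [map_add, mul_add, Finset.sum_add_distrib, h₁, h₂]
    abel
  | tmul z t =>
    have hz (i : ℕ+) (hi : i ∉ s) : Commute (star (rightRaise i)) (z : BH) :=
      (Subalgebra.mem_centralizer_iff ℂ).mp z.2 _ ⟨i, hi, rfl⟩
    induction X with
    | zero => simp
    | add X₁ X₂ h₁ h₂ =>
      simp only [map_add, add_mul, Finset.sum_add_distrib, h₁, h₂]
      abel
    | tmul x u =>
      simp only [Algebra.TensorProduct.map_tmul, Algebra.TensorProduct.tmul_mul_tmul, linExt_tmul,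
        AlgHom.id_apply, Subalgebra.coe_val, one_mul, mul_one, mul_assoc, smul_mul_smul_comm,
        state_mul_eq_add_sum hz, add_smul, Finset.sum_smul]

/-- The linear pencil `∑_l Ξ_l ⊗ a_l - 1 ⊗ Λ` over an arbitrary algebra `T`; besides the block
algebra itself, `T` will be its tensor square. -/
noncomputable def pencil (a : ℕ+ →₀ T) (Λ : T) : BH ⊗[ℂ] T :=
  (a.sum fun l x => Xi l ⊗ₜ x) - 1 ⊗ₜ Λ

/-- The `T`-valued Green function `φ_T((∑_l Ξ_l ⊗ a_l - 1 ⊗ Λ)⁻¹)`; it is `0` where the pencil is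
not invertible. -/
noncomputable def greenFun (a : ℕ+ →₀ T) (Λ : T) : T :=
  linExt state T (pencil a Λ)⁻¹ʳ

/-- The two-point Green function `φ_T((∑_l Ξ_l ⊗ a_l - 1 ⊗ Λ)⁻¹ (∑_l Ξ_l ⊗ b_l - 1 ⊗ Λ')⁻¹)`. The
product is taken in `T`: the function `G_{L₁,L₂}` is the case of a tensor square, with `a` and `b`
in different factors. -/
noncomputable def greenFun₂ (a b : ℕ+ →₀ T) (Λ Λ' : T) : T :=
  linExt state T ((pencil a Λ)⁻¹ʳ * (pencil b Λ')⁻¹ʳ)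

variable {a b : ℕ+ →₀ T} {Λ Λ' : T}

theorem lie_tmul_one_pencil (x : BH) (a : ℕ+ →₀ T) (Λ : T) :
    ⁅x ⊗ₜ[ℂ] (1 : T), pencil a Λ⁆ = a.sum fun l y => ⁅x, Xi l⁆ ⊗ₜ y := by
  simp only [Ring.lie_def, pencil, Finsupp.sum, mul_sub, sub_mul, Finset.mul_sum, Finset.sum_mul,
    Algebra.TensorProduct.tmul_mul_tmul, one_mul, mul_one, TensorProduct.sub_tmul,
    Finset.sum_sub_distrib, sub_sub_sub_cancel_right]

theorem lie_star_rightRaise_pencil (i : ℕ+) (a : ℕ+ →₀ T) (Λ : T) :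
    ⁅star (rightRaise i) ⊗ₜ[ℂ] (1 : T), pencil a Λ⁆ = vacuumProj ⊗ₜ a i := by
  simp only [lie_tmul_one_pencil, lie_star_rightRaise_Xi, TensorProduct.ite_tmul]
  rw [Finsupp.sum_ite_eq, ite_eq_left_iff]
  intro hi
  rw [Finsupp.notMem_support_iff.mp hi, TensorProduct.tmul_zero]

theorem lie_rightRaise_pencil (i : ℕ+) (a : ℕ+ →₀ T) (Λ : T) :
    ⁅rightRaise i ⊗ₜ[ℂ] (1 : T), pencil a Λ⁆ = -(vacuumProj ⊗ₜ a i) := by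
  simp only [lie_tmul_one_pencil, lie_rightRaise_Xi, TensorProduct.ite_tmul]
  rw [Finsupp.sum_ite_eq, TensorProduct.neg_tmul, ite_eq_left_iff]
  intro hi
  rw [Finsupp.notMem_support_iff.mp hi, TensorProduct.tmul_zero, neg_zero]

theorem star_rightRaise_mul_resolvent (ha : IsUnit (pencil a Λ)) (i : ℕ+) :
    star (rightRaise i) ⊗ₜ 1 * (pencil a Λ)⁻¹ʳ = (pencil a Λ)⁻¹ʳ * star (rightRaise i) ⊗ₜ 1
      - (pencil a Λ)⁻¹ʳ * vacuumProj ⊗ₜ a i * (pencil a Λ)⁻¹ʳ := by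
  have h := lie_ringInverse ha (star (rightRaise i) ⊗ₜ 1)
  rw [lie_star_rightRaise_pencil, Ring.lie_def, sub_eq_iff_eq_add] at h
  rw [h, neg_add_eq_sub]

theorem resolvent_mul_rightRaise (ha : IsUnit (pencil a Λ)) (i : ℕ+) :
    (pencil a Λ)⁻¹ʳ * rightRaise i ⊗ₜ 1 = rightRaise i ⊗ₜ 1 * (pencil a Λ)⁻¹ʳ
      - (pencil a Λ)⁻¹ʳ * vacuumProj ⊗ₜ a i * (pencil a Λ)⁻¹ʳ := by
  have h := lie_ringInverse ha (rightRaise i ⊗ₜ 1)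
  rw [lie_rightRaise_pencil, Ring.lie_def, mul_neg, neg_mul, neg_neg, sub_eq_iff_eq_add'] at h
  rw [h, add_sub_cancel_right]

theorem commute_star_rightRaise_resolvent (ha : IsUnit (pencil a Λ)) {i : ℕ+}
    (hi : i ∉ a.support) : Commute (star (rightRaise i) ⊗ₜ 1) (pencil a Λ)⁻¹ʳ := by
  rw [commute_iff_eq, star_rightRaise_mul_resolvent ha, Finsupp.notMem_support_iff.mp hi,
    TensorProduct.tmul_zero, mul_zero, zero_mul, sub_zero]

theorem linExt_resolvent_mul_vacuumProj_mul_resolvent (a b : ℕ+ →₀ T) (Λ Λ' x : T) :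
    linExt state T ((pencil a Λ)⁻¹ʳ * vacuumProj ⊗ₜ x * (pencil b Λ')⁻¹ʳ)
      = greenFun a Λ * x * greenFun b Λ' :=
  linExt_mul_tmul_mul state_mul_vacuumProj_mul _ _ _

theorem linExt_star_rightRaise_mul_resolvent (ha : IsUnit (pencil a Λ)) (i : ℕ+) :
    linExt state T (star (rightRaise i) ⊗ₜ 1 * (pencil a Λ)⁻¹ʳ)
      = -(greenFun a Λ * a i * greenFun a Λ) := by
  rw [star_rightRaise_mul_resolvent ha, map_sub,
    linExt_mul_tmul_eq_zero (state_mul_star_rightRaise · i),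
    linExt_resolvent_mul_vacuumProj_mul_resolvent, zero_sub]

theorem linExt_resolvent_mul_rightRaise (ha : IsUnit (pencil a Λ)) (i : ℕ+) :
    linExt state T ((pencil a Λ)⁻¹ʳ * rightRaise i ⊗ₜ 1)
      = -(greenFun a Λ * a i * greenFun a Λ) := by
  rw [resolvent_mul_rightRaise ha, map_sub, linExt_tmul_mul_eq_zero (state_rightRaise_mul i),
    linExt_resolvent_mul_vacuumProj_mul_resolvent, zero_sub]

theorem linExt_Xi_mul (l : ℕ+) (x : T) (Y : BH ⊗[ℂ] T) :
    linExt state T (Xi l ⊗ₜ x * Y) = x * linExt state T (star (rightRaise l) ⊗ₜ 1 * Y) := by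
  have h : state ∘ₗ LinearMap.mulLeft ℂ (Xi l)
      = state ∘ₗ LinearMap.mulLeft ℂ (star (rightRaise l)) :=
    LinearMap.ext (state_Xi_mul l)
  rw [linExt_tmul_mul, linExt_tmul_mul, h, one_mul]

theorem linExt_mul_Xi (X : BH ⊗[ℂ] T) (l : ℕ+) (x : T) :
    linExt state T (X * Xi l ⊗ₜ x) = linExt state T (X * rightRaise l ⊗ₜ 1) * x := by
  have h : state ∘ₗ LinearMap.mulRight ℂ (Xi l) = state ∘ₗ LinearMap.mulRight ℂ (rightRaise l) :=
    LinearMap.ext (state_mul_Xi · l)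
  rw [linExt_mul_tmul, linExt_mul_tmul, h, mul_one]

theorem linExt_one_tmul_mul (x : T) (Y : BH ⊗[ℂ] T) :
    linExt state T (1 ⊗ₜ x * Y) = x * linExt state T Y := by
  rw [linExt_tmul_mul, LinearMap.mulLeft_one, LinearMap.comp_id]

theorem linExt_mul_one_tmul (X : BH ⊗[ℂ] T) (x : T) :
    linExt state T (X * 1 ⊗ₜ x) = linExt state T X * x := by
  rw [linExt_mul_tmul, LinearMap.mulRight_one, LinearMap.comp_id]

theorem linExt_state_one : linExt state T 1 = 1 := by
  rw [Algebra.TensorProduct.one_def, linExt_tmul, state_one, one_smul]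

theorem schwingerDyson_left (ha : IsUnit (pencil a Λ)) :
    -(Λ + a.sum fun _ x => x * greenFun a Λ * x) * greenFun a Λ = 1 := by
  have h := congrArg (linExt state T) (Ring.mul_inverse_cancel _ ha)
  nth_rw 1 [pencil] at h
  rw [sub_mul, Finsupp.sum_mul, map_sub, Finsupp.sum, map_sum, linExt_one_tmul_mul,
    linExt_state_one] at h
  simp only [linExt_Xi_mul, linExt_star_rightRaise_mul_resolvent ha, mul_neg,
    Finset.sum_neg_distrib] at h
  rw [← h, Finsupp.sum, neg_mul, add_mul, Finset.sum_mul, neg_add_rev, sub_eq_add_neg]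
  simp only [mul_assoc, greenFun]

theorem schwingerDyson_right (ha : IsUnit (pencil a Λ)) :
    greenFun a Λ * -(Λ + a.sum fun _ x => x * greenFun a Λ * x) = 1 := by
  have h := congrArg (linExt state T) (Ring.inverse_mul_cancel _ ha)
  nth_rw 2 [pencil] at h
  rw [mul_sub, Finsupp.mul_sum, map_sub, Finsupp.sum, map_sum, linExt_mul_one_tmul,
    linExt_state_one] at h
  simp only [linExt_mul_Xi, linExt_resolvent_mul_rightRaise ha, neg_mul,
    Finset.sum_neg_distrib] at h
  rw [← h, Finsupp.sum, mul_neg, mul_add, Finset.mul_sum, neg_add_rev, sub_eq_add_neg]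
  simp only [mul_assoc, greenFun]

theorem isUnit_greenFun (ha : IsUnit (pencil a Λ)) : IsUnit (greenFun a Λ) :=
  ⟨⟨_, _, schwingerDyson_right ha, schwingerDyson_left ha⟩, rfl⟩

theorem greenFun₂_eq (ha : IsUnit (pencil a Λ)) (hb : IsUnit (pencil b Λ')) {s : Finset ℕ+}
    (hs : b.support ⊆ s) :
    greenFun₂ a b Λ Λ' = greenFun a Λ * greenFun b Λ'
      + ∑ i ∈ s, greenFun a Λ * a i * greenFun₂ a b Λ Λ' * (b i * greenFun b Λ') := by
  nth_rw 1 [greenFun₂]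
  rw [linExt_state_mul_eq_add_sum fun i hi => commute_star_rightRaise_resolvent hb (mt (@hs i) hi)]
  refine congrArg _ (Finset.sum_congr rfl fun i _ => ?_)
  rw [resolvent_mul_rightRaise ha, sub_mul, map_sub, mul_assoc (rightRaise i ⊗ₜ _),
    linExt_tmul_mul_eq_zero (state_rightRaise_mul i), zero_sub,
    star_rightRaise_mul_resolvent hb, mul_sub, map_sub, ← mul_assoc,
    linExt_mul_tmul_eq_zero (state_mul_star_rightRaise · i), zero_sub, neg_neg]
  calc linExt state T ((pencil a Λ)⁻¹ʳ * vacuumProj ⊗ₜ a i * (pencil a Λ)⁻¹ʳ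
        * ((pencil b Λ')⁻¹ʳ * vacuumProj ⊗ₜ b i * (pencil b Λ')⁻¹ʳ))
      = linExt state T ((pencil a Λ)⁻¹ʳ * vacuumProj ⊗ₜ a i
        * ((pencil a Λ)⁻¹ʳ * (pencil b Λ')⁻¹ʳ * vacuumProj ⊗ₜ b i * (pencil b Λ')⁻¹ʳ)) := by
        simp only [mul_assoc]
    _ = greenFun a Λ * a i * (greenFun₂ a b Λ Λ' * b i * greenFun b Λ') := by
        rw [linExt_mul_tmul_mul state_mul_vacuumProj_mul,
          linExt_mul_tmul_mul state_mul_vacuumProj_mul, greenFun, greenFun, greenFun₂]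
    _ = _ := by simp only [mul_assoc]

variable {S : Type*} [Ring S] [Algebra ℂ S]

theorem map_pencil (f : S →ₐ[ℂ] T) (a : ℕ+ →₀ S) (Λ : S) :
    Algebra.TensorProduct.map (AlgHom.id ℂ BH) f (pencil a Λ)
      = pencil (a.mapRange f (map_zero f)) (f Λ) := by
  rw [pencil, pencil, Finsupp.sum_mapRange_index fun _ => TensorProduct.tmul_zero _ _, map_sub,
    map_finsuppSum]
  simp only [Algebra.TensorProduct.map_tmul, AlgHom.id_apply]

theorem isUnit_pencil_mapRange {a : ℕ+ →₀ S} {Λ : S} (ha : IsUnit (pencil a Λ)) (f : S →ₐ[ℂ] T) :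
    IsUnit (pencil (a.mapRange f (map_zero f)) (f Λ)) := by
  rw [← map_pencil]
  exact ha.map _

theorem map_resolvent {a : ℕ+ →₀ S} {Λ : S} (ha : IsUnit (pencil a Λ)) (f : S →ₐ[ℂ] T) :
    Algebra.TensorProduct.map (AlgHom.id ℂ BH) f (pencil a Λ)⁻¹ʳ
      = (pencil (a.mapRange f (map_zero f)) (f Λ))⁻¹ʳ := by
  rw [map_ringInverse _ ha, map_pencil]

theorem greenFun_mapRange {a : ℕ+ →₀ S} {Λ : S} (ha : IsUnit (pencil a Λ)) (f : S →ₐ[ℂ] T) :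
    greenFun (a.mapRange f (map_zero f)) (f Λ) = f (greenFun a Λ) := by
  rw [greenFun, ← map_resolvent ha, linExt_map, greenFun]

end Pencil

namespace Transposition

variable {A : Type*} [Ring A] [StarRing A] [Algebra ℂ A] (t : Transposition A)

theorem map_one : t.toLin 1 = 1 := by
  rw [← mul_one (t.toLin 1), ← t.involutive (t.toLin 1 * 1), t.map_mul, t.involutive, mul_one,
    t.involutive]

/-- The map `1 ⊗ T` of `A ⊗ A` induced by a transposition `T` of `A`; `halfTranspose` is the case
of a block algebra. -/
noncomputable def half : A ⊗[ℂ] A →ₗ[ℂ] A ⊗[ℂ] A :=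
  TensorProduct.map LinearMap.id t.toLin

theorem half_tmul (x y : A) : t.half (x ⊗ₜ y) = x ⊗ₜ t.toLin y := rfl

theorem half_half (Z : A ⊗[ℂ] A) : t.half (t.half Z) = Z := by
  induction Z with
  | zero => simp
  | add Z₁ Z₂ h₁ h₂ => rw [_root_.map_add, _root_.map_add, h₁, h₂]
  | tmul x y => rw [half_tmul, half_tmul, t.involutive]

theorem half_left_mul_mul_right (x y : A) (Z : A ⊗[ℂ] A) :
    t.half (x ⊗ₜ 1 * Z * 1 ⊗ₜ y) = x ⊗ₜ t.toLin y * t.half Z := by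
  induction Z with
  | zero => simp
  | add Z₁ Z₂ h₁ h₂ => rw [mul_add, add_mul, _root_.map_add, _root_.map_add, mul_add, h₁, h₂]
  | tmul u v => simp [half_tmul, t.map_mul]

theorem half_right_mul_mul_left (x y : A) (Z : A ⊗[ℂ] A) :
    t.half (1 ⊗ₜ y * Z * x ⊗ₜ 1) = t.half Z * x ⊗ₜ t.toLin y := by
  induction Z with
  | zero => simp
  | add Z₁ Z₂ h₁ h₂ => rw [mul_add, add_mul, _root_.map_add, _root_.map_add, add_mul, h₁, h₂]
  | tmul u v => simp [half_tmul, t.map_mul]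

theorem half_finsuppSum {ι : Type*} {a₁ a₂ : ι →₀ A} {s : Finset ι} (hs : a₁.support ⊆ s) :
    t.half (a₁.sum fun l x => x ⊗ₜ a₂ l) = ∑ l ∈ s, a₁ l ⊗ₜ t.toLin (a₂ l) := by
  rw [Finsupp.sum_of_support_subset a₁ hs (fun l x => x ⊗ₜ a₂ l)
    fun l _ => TensorProduct.zero_tmul A (a₂ l), map_sum]
  rfl

theorem half_ringInverse_mul_half {x y : A} (hx : IsUnit x) (hy : IsUnit y) :
    t.half (x⁻¹ʳ ⊗ₜ y⁻¹ʳ) * t.half (x ⊗ₜ y) = 1 := by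
  rw [t.half_tmul, t.half_tmul, Algebra.TensorProduct.tmul_mul_tmul, ← t.map_mul,
    Ring.inverse_mul_cancel _ hx, Ring.mul_inverse_cancel _ hy, t.map_one,
    Algebra.TensorProduct.one_def]

theorem half_mul_half_ringInverse {x y : A} (hx : IsUnit x) (hy : IsUnit y) :
    t.half (x ⊗ₜ y) * t.half (x⁻¹ʳ ⊗ₜ y⁻¹ʳ) = 1 := by
  rw [t.half_tmul, t.half_tmul, Algebra.TensorProduct.tmul_mul_tmul, ← t.map_mul,
    Ring.mul_inverse_cancel _ hx, Ring.inverse_mul_cancel _ hy, t.map_one,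
    Algebra.TensorProduct.one_def]

end Transposition

section TensorSquare

open BoltzmannFock Algebra.TensorProduct

variable {S : Type*} [Ring S] [Algebra ℂ S] {a₁ a₂ : ℕ+ →₀ S} {Λ₁ Λ₂ : S}

/-- `φ_{S,S}(R₁, R₂)` for the resolvents `R_j` of the pencils with coefficients `a_j`, written as
the two-point Green function over `S ⊗ S` with `R_j` acting in the `j`-th factor. -/
noncomputable def crossGreenFun (a₁ a₂ : ℕ+ →₀ S) (Λ₁ Λ₂ : S) : S ⊗[ℂ] S :=
  greenFun₂ (a₁.mapRange (includeLeft : S →ₐ[ℂ] S ⊗[ℂ] S) (map_zero _))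
    (a₂.mapRange (includeRight : S →ₐ[ℂ] S ⊗[ℂ] S) (map_zero _))
    ((includeLeft : S →ₐ[ℂ] S ⊗[ℂ] S) Λ₁) ((includeRight : S →ₐ[ℂ] S ⊗[ℂ] S) Λ₂)

/-- As `crossGreenFun`, but with the resolvents multiplied in the order `R₂ R₁`. The half-transposes
of the two turn out to be equal, as the right and the left inverse of one element. -/
noncomputable def crossGreenFunRev (a₁ a₂ : ℕ+ →₀ S) (Λ₁ Λ₂ : S) : S ⊗[ℂ] S :=
  greenFun₂ (a₂.mapRange (includeRight : S →ₐ[ℂ] S ⊗[ℂ] S) (map_zero _))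
    (a₁.mapRange (includeLeft : S →ₐ[ℂ] S ⊗[ℂ] S) (map_zero _))
    ((includeRight : S →ₐ[ℂ] S ⊗[ℂ] S) Λ₂) ((includeLeft : S →ₐ[ℂ] S ⊗[ℂ] S) Λ₁)

theorem bilinExt_resolvent (h₁ : IsUnit (pencil a₁ Λ₁)) (h₂ : IsUnit (pencil a₂ Λ₂)) :
    bilinExt state S (pencil a₁ Λ₁)⁻¹ʳ (pencil a₂ Λ₂)⁻¹ʳ = crossGreenFun a₁ a₂ Λ₁ Λ₂ := by
  rw [bilinExt_eq_linExt, map_resolvent h₁, map_resolvent h₂, crossGreenFun, greenFun₂]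

theorem crossGreenFun_eq (h₁ : IsUnit (pencil a₁ Λ₁)) (h₂ : IsUnit (pencil a₂ Λ₂))
    {s : Finset ℕ+} (hs : a₂.support ⊆ s) :
    crossGreenFun a₁ a₂ Λ₁ Λ₂ = greenFun a₁ Λ₁ ⊗ₜ greenFun a₂ Λ₂
      + ∑ i ∈ s, (greenFun a₁ Λ₁ * a₁ i) ⊗ₜ 1 * crossGreenFun a₁ a₂ Λ₁ Λ₂
          * 1 ⊗ₜ (a₂ i * greenFun a₂ Λ₂) := by
  have h := greenFun₂_eq (isUnit_pencil_mapRange h₁ includeLeft)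
    (isUnit_pencil_mapRange h₂ includeRight) (Finsupp.support_mapRange.trans hs)
  rw [← crossGreenFun, greenFun_mapRange h₁, greenFun_mapRange h₂] at h
  simpa only [Finsupp.mapRange_apply, includeLeft_apply, includeRight_apply, tmul_mul_tmul,
    one_mul, mul_one] using h

theorem crossGreenFunRev_eq (h₁ : IsUnit (pencil a₁ Λ₁)) (h₂ : IsUnit (pencil a₂ Λ₂))
    {s : Finset ℕ+} (hs : a₁.support ⊆ s) :
    crossGreenFunRev a₁ a₂ Λ₁ Λ₂ = greenFun a₁ Λ₁ ⊗ₜ greenFun a₂ Λ₂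
      + ∑ i ∈ s, 1 ⊗ₜ (greenFun a₂ Λ₂ * a₂ i) * crossGreenFunRev a₁ a₂ Λ₁ Λ₂
          * (a₁ i * greenFun a₁ Λ₁) ⊗ₜ 1 := by
  have h := greenFun₂_eq (isUnit_pencil_mapRange h₂ includeRight)
    (isUnit_pencil_mapRange h₁ includeLeft) (Finsupp.support_mapRange.trans hs)
  rw [← crossGreenFunRev, greenFun_mapRange h₁, greenFun_mapRange h₂] at h
  simpa only [Finsupp.mapRange_apply, includeLeft_apply, includeRight_apply, tmul_mul_tmul,
    one_mul, mul_one] using h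

end TensorSquare

section HalfTranspose

variable {S : Type*} [Ring S] [StarRing S] [Algebra ℂ S] (t : Transposition S)
  {a₁ a₂ : ℕ+ →₀ S} {Λ₁ Λ₂ : S}

theorem half_crossGreenFun_eq (h₁ : IsUnit (pencil a₁ Λ₁)) (h₂ : IsUnit (pencil a₂ Λ₂)) :
    t.half (crossGreenFun a₁ a₂ Λ₁ Λ₂) = t.half (greenFun a₁ Λ₁ ⊗ₜ greenFun a₂ Λ₂)
      + t.half (greenFun a₁ Λ₁ ⊗ₜ greenFun a₂ Λ₂) * t.half (a₁.sum fun l x => x ⊗ₜ a₂ l)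
        * t.half (crossGreenFun a₁ a₂ Λ₁ Λ₂) := by
  rw [t.half_finsuppSum (Finset.subset_union_left (s₂ := a₂.support))]
  nth_rw 1 [crossGreenFun_eq h₁ h₂ (Finset.subset_union_right (s₁ := a₁.support))]
  simp only [map_add, map_sum, t.half_left_mul_mul_right, t.half_tmul, t.map_mul, Finset.mul_sum,
    Finset.sum_mul, Algebra.TensorProduct.tmul_mul_tmul]

theorem half_crossGreenFunRev_eq (h₁ : IsUnit (pencil a₁ Λ₁)) (h₂ : IsUnit (pencil a₂ Λ₂)) :
    t.half (crossGreenFunRev a₁ a₂ Λ₁ Λ₂) = t.half (greenFun a₁ Λ₁ ⊗ₜ greenFun a₂ Λ₂)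
      + t.half (crossGreenFunRev a₁ a₂ Λ₁ Λ₂) * t.half (a₁.sum fun l x => x ⊗ₜ a₂ l)
        * t.half (greenFun a₁ Λ₁ ⊗ₜ greenFun a₂ Λ₂) := by
  rw [t.half_finsuppSum subset_rfl]
  nth_rw 1 [crossGreenFunRev_eq h₁ h₂ subset_rfl]
  simp only [map_add, map_sum, t.half_right_mul_mul_left, t.half_tmul, t.map_mul, Finset.mul_sum,
    Finset.sum_mul, mul_assoc (t.half _), Algebra.TensorProduct.tmul_mul_tmul]

theorem half_mul_half_crossGreenFun (h₁ : IsUnit (pencil a₁ Λ₁)) (h₂ : IsUnit (pencil a₂ Λ₂)) :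
    t.half ((greenFun a₁ Λ₁)⁻¹ʳ ⊗ₜ (greenFun a₂ Λ₂)⁻¹ʳ - a₁.sum fun l x => x ⊗ₜ a₂ l)
      * t.half (crossGreenFun a₁ a₂ Λ₁ Λ₂) = 1 := by
  rw [map_sub]
  exact sub_mul_eq_one_of_eq_add
    (t.half_ringInverse_mul_half (isUnit_greenFun h₁) (isUnit_greenFun h₂))
    (half_crossGreenFun_eq t h₁ h₂)

theorem half_crossGreenFunRev_mul_half (h₁ : IsUnit (pencil a₁ Λ₁))
    (h₂ : IsUnit (pencil a₂ Λ₂)) :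
    t.half (crossGreenFunRev a₁ a₂ Λ₁ Λ₂)
      * t.half ((greenFun a₁ Λ₁)⁻¹ʳ ⊗ₜ (greenFun a₂ Λ₂)⁻¹ʳ - a₁.sum fun l x => x ⊗ₜ a₂ l) = 1 := by
  rw [map_sub]
  exact mul_sub_eq_one_of_eq_add
    (t.half_mul_half_ringInverse (isUnit_greenFun h₁) (isUnit_greenFun h₂))
    (half_crossGreenFunRev_eq t h₁ h₂)

theorem half_crossGreenFun_mul_half (h₁ : IsUnit (pencil a₁ Λ₁)) (h₂ : IsUnit (pencil a₂ Λ₂)) :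
    t.half (crossGreenFun a₁ a₂ Λ₁ Λ₂)
      * t.half ((greenFun a₁ Λ₁)⁻¹ʳ ⊗ₜ (greenFun a₂ Λ₂)⁻¹ʳ - a₁.sum fun l x => x ⊗ₜ a₂ l) = 1 := by
  rw [← left_inv_eq_right_inv (half_crossGreenFunRev_mul_half t h₁ h₂)
    (half_mul_half_crossGreenFun t h₁ h₂)]
  exact half_crossGreenFunRev_mul_half t h₁ h₂

end HalfTranspose

section SpecialFunctions

open BoltzmannFock

variable {S : Type*} [CStarAlgebra S] {L L₁ L₂ : FreeAlgebra ℂ ℕ+ ⊗[ℂ] S} {a a₁ a₂ : ℕ+ →₀ S}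
  {Λ₁ Λ₂ : S}

theorem HasHamelExpansion.shifted_eq (hL : HasHamelExpansion L a) (Λ : S) :
    shifted L Λ = pencil a Λ := by
  rw [shifted, hL.evalAt_eq, pencil]

theorem HasHamelExpansion.isUnit_pencil (hL : HasHamelExpansion L a) {Λ : S}
    (hΛ : Λ ∈ domainD L) : IsUnit (pencil a Λ) :=
  hL.shifted_eq Λ ▸ hΛ

theorem HasHamelExpansion.funG_eq (hL : HasHamelExpansion L a) (Λ : S) :
    funG L Λ = greenFun a Λ := by
  rw [funG, hL.shifted_eq, greenFun]

theorem HasHamelExpansion.funGG_eq (hL₁ : HasHamelExpansion L₁ a₁)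
    (hL₂ : HasHamelExpansion L₂ a₂) (hΛ₁ : Λ₁ ∈ domainD L₁) (hΛ₂ : Λ₂ ∈ domainD L₂) :
    funGG L₁ L₂ Λ₁ Λ₂ = crossGreenFun a₁ a₂ Λ₁ Λ₂ := by
  rw [funGG, hL₁.shifted_eq, hL₂.shifted_eq,
    bilinExt_resolvent (hL₁.isUnit_pencil hΛ₁) (hL₂.isUnit_pencil hΛ₂)]

end SpecialFunctions

theorem proposition5p6_general {S : Type*} [CStarAlgebra S] (t : Transposition S)
    (L₁ L₂ : FreeAlgebra ℂ ℕ+ ⊗[ℂ] S) (a₁ a₂ : ℕ+ →₀ S)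
    (hL₁ : HasHamelExpansion L₁ a₁) (hL₂ : HasHamelExpansion L₂ a₂)
    (Λ₁ Λ₂ : S) (hΛ₁ : Λ₁ ∈ domainD L₁) (hΛ₂ : Λ₂ ∈ domainD L₂) :
    IsUnit (funG L₁ Λ₁) ∧ IsUnit (funG L₂ Λ₂) ∧
    IsUnit (t.half ((funG L₁ Λ₁)⁻¹ʳ ⊗ₜ[ℂ] (funG L₂ Λ₂)⁻¹ʳ - a₁.sum fun l x => x ⊗ₜ[ℂ] a₂ l)) ∧
    funGG L₁ L₂ Λ₁ Λ₂ =
      t.half (t.half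
        ((funG L₁ Λ₁)⁻¹ʳ ⊗ₜ[ℂ] (funG L₂ Λ₂)⁻¹ʳ - a₁.sum fun l x => x ⊗ₜ[ℂ] a₂ l))⁻¹ʳ := by
  have h₁ := hL₁.isUnit_pencil hΛ₁
  have h₂ := hL₂.isUnit_pencil hΛ₂
  have hright := half_mul_half_crossGreenFun t h₁ h₂
  have hleft := half_crossGreenFun_mul_half t h₁ h₂
  rw [hL₁.funG_eq, hL₂.funG_eq, hL₁.funGG_eq hL₂ hΛ₁ hΛ₂]
  refine ⟨isUnit_greenFun h₁, isUnit_greenFun h₂, ⟨⟨_, _, hright, hleft⟩, rfl⟩, ?_⟩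
  rw [ringInverse_eq_of_mul_eq_one hright hleft, t.half_half]

theorem proposition5p6 {S : Type*} [CStarAlgebra S] [BlockAlgebra S]
    (L₁ L₂ : FreeAlgebra ℂ ℕ+ ⊗[ℂ] S) (a₁ a₂ : ℕ+ →₀ S)
    (hL₁ : HasHamelExpansion L₁ a₁) (hL₂ : HasHamelExpansion L₂ a₂)
    (Λ₁ Λ₂ : S) (hΛ₁ : Λ₁ ∈ domainD L₁) (hΛ₂ : Λ₂ ∈ domainD L₂) :
    IsUnit (funG L₁ Λ₁) ∧ IsUnit (funG L₂ Λ₂) ∧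
    IsUnit (halfTranspose S
      (Ring.inverse (funG L₁ Λ₁) ⊗ₜ[ℂ] Ring.inverse (funG L₂ Λ₂)
        - a₁.sum fun l x => x ⊗ₜ[ℂ] a₂ l)) ∧
    funGG L₁ L₂ Λ₁ Λ₂ =
      halfTranspose S (Ring.inverse (halfTranspose S
        (Ring.inverse (funG L₁ Λ₁) ⊗ₜ[ℂ] Ring.inverse (funG L₂ Λ₂)
          - a₁.sum fun l x => x ⊗ₜ[ℂ] a₂ l))) :=
  proposition5p6_general BlockAlgebra.transposition L₁ L₂ a₁ a₂ hL₁ hL₂ Λ₁ Λ₂ hΛ₁ hΛ₂
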